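/- Let $J\subseteq\mathbb R$ be an interval, let $g:J\to\mathbb R$ be locally Lipschitz, let $\alpha\in\mathbb R$, and let $\beta,\lambda\in J$ with $0\le\beta<\lambda$. Suppose that $g(x)>0$ for all $x\in[\beta,\lambda)$ and that $g(\lambda)=0$. Then the boundary value problem $$f'''+f f''+g(f')=0\ \text{ on }[0,\infty),\qquad f(0)=\alpha,\qquad f'(0)=\beta,\qquad \lim_{t\to\infty}f'(t)=\lambda$$ has exactly one convex solution, that is, there is exactly one three times differentiable convex function $f:[0,\infty)\to\mathbb R$, with $f'(t)\in J$ for all $t\ge 0$ (derivatives at $0$ being one-sided), that satisfies the equation and the three boundary conditions. -/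

import Mathlib

namespace SimilarityBL

open Set Filter Topology

/-- The derivative of a function on the half-line `[0, ∞)` (one-sided at the end point `0`).
Only the values of `f` on `[0, ∞)` matter for its values on `[0, ∞)`. -/
noncomputable def D (f : ℝ → ℝ) : ℝ → ℝ := fun t => derivWithin f (Ici 0) t

/-- `f` is a (classical, global) solution on `[0, ∞)` of
`f''' + f f'' + g(f') = 0`, `f 0 = α`, `f' 0 = β`, `f'(t) → lam` as `t → ∞`,
where `g` is regarded as a function on the interval `J` only, so that `f'` has to take its
values in `J`. -/
structure IsSolution (g : ℝ → ℝ) (J : Set ℝ) (α β lam : ℝ) (f : ℝ → ℝ) : Prop where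
  diff_zero : DifferentiableOn ℝ f (Ici 0)
  diff_one : DifferentiableOn ℝ (D f) (Ici 0)
  diff_two : DifferentiableOn ℝ (D (D f)) (Ici 0)
  mem_domain : ∀ t ∈ Ici (0 : ℝ), D f t ∈ J
  ode : ∀ t ∈ Ici (0 : ℝ), D (D (D f)) t + f t * D (D f) t + g (D f t) = 0
  value_zero : f 0 = α
  deriv_zero : D f 0 = β
  deriv_infty : Tendsto (D f) atTop (𝓝 lam)

/-- A solution of the boundary value problem that is convex on `[0, ∞)`. -/
def IsConvexSolution (g : ℝ → ℝ) (J : Set ℝ) (α β lam : ℝ) (f : ℝ → ℝ) : Prop :=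
  IsSolution g J α β lam f ∧ ConvexOn ℝ (Ici 0) f

end SimilarityBL

namespace SimilarityBL

open Set Filter Topology
open scoped NNReal

/-- The truncation of `x` to the interval `[a, b]`. -/
noncomputable def clamp (a b x : ℝ) : ℝ := max a (min b x)

lemma clamp_mem {a b : ℝ} (h : a ≤ b) (x : ℝ) : clamp a b x ∈ Icc a b :=
  ⟨le_max_left _ _, max_le h (min_le_left _ _)⟩

lemma clamp_of_mem {a b x : ℝ} (h : x ∈ Icc a b) : clamp a b x = x := by
  rw [clamp, min_eq_right h.2, max_eq_right h.1]

lemma clamp_of_le {a b x : ℝ} (hab : a ≤ b) (h : x ≤ a) : clamp a b x = a := by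
  rw [clamp, min_eq_right (h.trans hab), max_eq_left h]

lemma clamp_of_ge {a b x : ℝ} (hab : a ≤ b) (h : b ≤ x) : clamp a b x = b := by
  rw [clamp, min_eq_left h, max_eq_right hab]

lemma abs_clamp_sub_clamp_le (a b x y : ℝ) : |clamp a b x - clamp a b y| ≤ |x - y| := by
  have h := abs_max_sub_max_le_max a (min b x) a (min b y)
  have h' := abs_min_sub_min_le_max b x b y
  rw [sub_self, abs_zero, max_eq_right (abs_nonneg (min b x - min b y))] at h
  rw [sub_self, abs_zero, max_eq_right (abs_nonneg (x - y))] at h'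
  exact h.trans h'

/-- The first order system equivalent to `f''' + f f'' + g(f') = 0`, with `f'` truncated to
`[β, lam]` and `f''` truncated to `[0, W]`. -/
noncomputable def field (g : ℝ → ℝ) (β lam W : ℝ) (x : ℝ × ℝ × ℝ) : ℝ × ℝ × ℝ :=
  (clamp β lam x.2.1, clamp 0 W x.2.2,
    -(x.1 * clamp 0 W x.2.2) - g (clamp β lam x.2.1))

/-- The vector field `field` with `f` truncated to `[-M, M]` as well. -/
noncomputable def truncField (g : ℝ → ℝ) (β lam W M : ℝ) (x : ℝ × ℝ × ℝ) : ℝ × ℝ × ℝ :=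
  field g β lam W (clamp (-M) M x.1, x.2)

/-- `X` is an integral curve of `v` on `[0, T]`. -/
def IsCurve {E : Type*} [NormedAddCommGroup E] [NormedSpace ℝ E] (v : E → E) (T : ℝ)
    (X : ℝ → E) : Prop :=
  ∀ t ∈ Icc 0 T, HasDerivWithinAt X (v (X t)) (Icc 0 T) t

lemma IsCurve.continuousOn {E : Type*} [NormedAddCommGroup E] [NormedSpace ℝ E] {v : E → E}
    {T : ℝ} {X : ℝ → E} (h : IsCurve v T X) : ContinuousOn X (Icc 0 T) :=
  fun t ht => (h t ht).continuousWithinAt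

lemma IsCurve.hasDerivWithinAt_Ici {E : Type*} [NormedAddCommGroup E] [NormedSpace ℝ E]
    {v : E → E} {T : ℝ} {X : ℝ → E} (h : IsCurve v T X) :
    ∀ t ∈ Ico 0 T, HasDerivWithinAt X (v (X t)) (Ici t) t := fun t ht =>
  (h t (Ico_subset_Icc_self ht)).mono_of_mem_nhdsWithin (Icc_mem_nhdsGE_of_mem ht)

lemma IsCurve.dist_le {E : Type*} [NormedAddCommGroup E] [NormedSpace ℝ E] {v : E → E}
    {T : ℝ} {X Y : ℝ → E} {K : ℝ≥0} (hv : LipschitzWith K v) (hX : IsCurve v T X)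
    (hY : IsCurve v T Y) : ∀ t ∈ Icc 0 T, dist (X t) (Y t) ≤ dist (X 0) (Y 0) * Real.exp (K * t) := by
  intro t ht
  have := dist_le_of_trajectories_ODE (v := fun _ => v) (fun _ => hv) hX.continuousOn
    hX.hasDerivWithinAt_Ici hY.continuousOn hY.hasDerivWithinAt_Ici le_rfl t ht
  simpa using this

lemma IsCurve.mono {E : Type*} [NormedAddCommGroup E] [NormedSpace ℝ E] {v : E → E}
    {T S : ℝ} {X : ℝ → E} (h : IsCurve v T X) (hS : S ≤ T) : IsCurve v S X := fun t ht =>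
  (h t ⟨ht.1, ht.2.trans hS⟩).mono (Icc_subset_Icc_right hS)

/-- A bounded Lipschitz vector field has integral curves on arbitrarily long intervals. -/
lemma exists_isCurve {E : Type*} [NormedAddCommGroup E] [NormedSpace ℝ E] [CompleteSpace E]
    {v : E → E} {K L : ℝ≥0} (hv : LipschitzWith K v) (hL : ∀ x, ‖v x‖ ≤ L) {T : ℝ} (hT : 0 ≤ T)
    (x₀ : E) : ∃ X, X 0 = x₀ ∧ IsCurve v T X := by
  have : IsPicardLindelof (fun _ => v) (⟨0, le_rfl, hT⟩ : Icc 0 T) x₀ (L * T.toNNReal) 0 L K := by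
    refine ⟨fun t _ => hv.lipschitzOnWith, fun x _ => continuousOn_const, fun t _ x _ => hL x, ?_⟩
    simp [hT]
  exact this.exists_eq_forall_mem_Icc_hasDerivWithinAt₀

/-- Local integral curves glue to a global one if they are unique. -/
lemma exists_global_curve {E : Type*} [NormedAddCommGroup E] [NormedSpace ℝ E] {v : E → E} {x₀ : E}
    (hex : ∀ n : ℕ, ∃ X, X 0 = x₀ ∧ IsCurve v n X)
    (huniq : ∀ T X Y, X 0 = x₀ → Y 0 = x₀ → IsCurve v T X → IsCurve v T Y → EqOn X Y (Icc 0 T)) :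
    ∃ X : ℝ → E, X 0 = x₀ ∧ ∀ t ∈ Ici (0 : ℝ), HasDerivWithinAt X (v (X t)) (Ici 0) t := by
  choose X hX0 hX using hex
  have key : ∀ n : ℕ, ∀ s ∈ Ico (0 : ℝ) n, X (⌈s⌉₊ + 1) s = X n s := by
    intro n s hs
    have hs' : s ≤ (⌈s⌉₊ + 1 : ℕ) := (Nat.le_ceil s).trans (by simp)
    exact huniq s _ _ (hX0 _) (hX0 _) ((hX _).mono hs') ((hX _).mono hs.2.le) ⟨hs.1, le_rfl⟩
  refine ⟨fun t => X (⌈t⌉₊ + 1) t, by simp [hX0], fun t ht => ?_⟩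
  have ht' : t < (⌈t⌉₊ + 1 : ℕ) := (Nat.le_ceil t).trans_lt (by simp)
  have hn : Ico (0 : ℝ) (⌈t⌉₊ + 1 : ℕ) ∈ 𝓝[Ici 0] t := by
    rw [← Ici_inter_Iio]
    exact inter_mem_nhdsWithin _ (Iio_mem_nhds ht')
  refine (((hX (⌈t⌉₊ + 1)) t ⟨ht, ht'.le⟩).mono_of_mem_nhdsWithin
    (mem_of_superset hn Ico_subset_Icc_self)).congr_of_eventuallyEq ?_ rfl
  filter_upwards [hn] with s hs
  exact key _ s hs

section
variable {g : ℝ → ℝ} {β lam W M : ℝ} {Kg : ℝ≥0}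

lemma lipschitzWith_truncField (hβl : β ≤ lam) (hW : 0 ≤ W) (hM : 0 ≤ M)
    (hg : LipschitzOnWith Kg g (Icc β lam)) :
    ∃ K, LipschitzWith K (truncField g β lam W M) := by
  refine ⟨1 + M.toNNReal + W.toNNReal + Kg, LipschitzWith.of_dist_le_mul fun x y => ?_⟩
  have h1 : |x.1 - y.1| ≤ dist x y := le_max_left _ _
  have h2 : |x.2.1 - y.2.1| ≤ dist x y := (le_max_left _ _).trans (le_max_right _ _)
  have h3 : |x.2.2 - y.2.2| ≤ dist x y := (le_max_right _ _).trans (le_max_right _ _)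
  have c1 := (abs_clamp_sub_clamp_le (-M) M x.1 y.1).trans h1
  have c2 := (abs_clamp_sub_clamp_le β lam x.2.1 y.2.1).trans h2
  have c3 := (abs_clamp_sub_clamp_le 0 W x.2.2 y.2.2).trans h3
  have m1 : |clamp (-M) M x.1| ≤ M := abs_le.2 (clamp_mem (by linarith) _)
  have m3 := clamp_mem hW y.2.2
  have hgl := hg.dist_le_mul _ (clamp_mem hβl x.2.1) _ (clamp_mem hβl y.2.1)
  rw [Real.dist_eq, Real.dist_eq] at hgl
  set d := dist x y with hd
  have hd0 : 0 ≤ d := dist_nonneg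
  have e1 : 0 ≤ M * d := by positivity
  have e2 : 0 ≤ W * d := by positivity
  have e3 : 0 ≤ Kg * d := by positivity
  have hcoe : ((1 + M.toNNReal + W.toNNReal + Kg : ℝ≥0) : ℝ) * d = d + M * d + W * d + Kg * d := by
    push_cast
    rw [Real.coe_toNNReal _ hM, Real.coe_toNNReal _ hW]
    ring
  rw [hcoe]
  refine max_le ?_ (max_le ?_ ?_)
  · exact c2.trans (by linarith)
  · exact c3.trans (by linarith)
  · simp only [truncField, field, Real.dist_eq]
    set a := clamp (-M) M x.1
    set a' := clamp (-M) M y.1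
    set b := clamp 0 W x.2.2
    set b' := clamp 0 W y.2.2
    set p := g (clamp β lam x.2.1)
    set p' := g (clamp β lam y.2.1)
    have : -(a * b) - p - (-(a' * b') - p') = -(a * (b - b')) - ((a - a') * b') - (p - p') := by
      ring
    rw [this]
    have q1 : |a * (b - b')| ≤ M * d := by
      rw [abs_mul]; exact mul_le_mul m1 c3 (abs_nonneg _) hM
    have q2 : |(a - a') * b'| ≤ W * d := by
      rw [abs_mul, abs_of_nonneg m3.1, mul_comm]
      exact mul_le_mul m3.2 c1 (abs_nonneg _) hW
    have q3 : |p - p'| ≤ Kg * d := hgl.trans (by gcongr)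
    rw [abs_le] at *
    constructor <;> linarith [q1.1, q1.2, q2.1, q2.2, q3.1, q3.2]

lemma norm_truncField_le (hβ : 0 ≤ β) (hβl : β ≤ lam) (hW : 0 ≤ W) (hM : 0 ≤ M)
    (hg : LipschitzOnWith Kg g (Icc β lam)) :
    ∃ L : ℝ≥0, ∀ x, ‖truncField g β lam W M x‖ ≤ L := by
  obtain ⟨G, hG⟩ := isCompact_Icc.exists_bound_of_continuousOn hg.continuousOn
  have hG0 : 0 ≤ G := (norm_nonneg _).trans (hG β ⟨le_rfl, hβl⟩)
  have hl : 0 ≤ lam := hβ.trans hβl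
  refine ⟨⟨lam + W + M * W + G, by positivity⟩, fun x => ?_⟩
  have m1 : |clamp (-M) M x.1| ≤ M := abs_le.2 (clamp_mem (by linarith) _)
  have m2 := clamp_mem hβl x.2.1
  have m3 := clamp_mem hW x.2.2
  have hMW : 0 ≤ M * W := by positivity
  refine max_le ?_ (max_le ?_ ?_)
  · change |clamp β lam x.2.1| ≤ lam + W + M * W + G
    rw [abs_le]; constructor <;> linarith [m2.1, m2.2]
  · change |clamp 0 W x.2.2| ≤ lam + W + M * W + G
    rw [abs_le]; constructor <;> linarith [m3.1, m3.2]
  · change |-(clamp (-M) M x.1 * clamp 0 W x.2.2) - g (clamp β lam x.2.1)| ≤ lam + W + M * W + G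
    have q1 : |clamp (-M) M x.1 * clamp 0 W x.2.2| ≤ M * W := by
      rw [abs_mul, abs_of_nonneg m3.1]
      exact mul_le_mul m1 m3.2 m3.1 hM
    have q2 := hG _ m2
    rw [Real.norm_eq_abs] at q2
    rw [abs_le] at *
    constructor <;> linarith [q1.1, q1.2, q2.1, q2.2]

lemma truncField_eq {x : ℝ × ℝ × ℝ} (h : |x.1| ≤ M) :
    truncField g β lam W M x = field g β lam W x := by
  rw [truncField, clamp_of_mem (abs_le.1 h)]

/-- The first component of an integral curve grows at most linearly. -/
lemma IsCurve.abs_fst_le {v : ℝ × ℝ × ℝ → ℝ × ℝ × ℝ} (hv : ∀ x, |(v x).1| ≤ lam) {T : ℝ}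
    {X : ℝ → ℝ × ℝ × ℝ} (hX : IsCurve v T X) :
    ∀ t ∈ Icc 0 T, |(X t).1| ≤ |(X 0).1| + lam * T := by
  intro t ht
  have hl : 0 ≤ lam := (abs_nonneg _).trans (hv 0)
  have := (convex_Icc 0 T).norm_image_sub_le_of_norm_hasDerivWithin_le (f := fun t => (X t).1)
    (f' := fun t => (v (X t)).1) (C := lam) (fun s hs => (hX s hs).fst) (fun s _ => hv _)
    (show (0 : ℝ) ∈ Icc 0 T from ⟨le_rfl, ht.1.trans ht.2⟩) ht
  rw [Real.norm_eq_abs, Real.norm_eq_abs, sub_zero, abs_of_nonneg ht.1] at this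
  have h2 : lam * t ≤ lam * T := by gcongr; exact ht.2
  have h3 := abs_sub_abs_le_abs_sub (X t).1 (X 0).1
  linarith

lemma abs_field_fst_le (hβ : 0 ≤ β) (hβl : β ≤ lam) (x : ℝ × ℝ × ℝ) :
    |(field g β lam W x).1| ≤ lam := by
  have := clamp_mem hβl x.2.1
  have h1 := this.1
  exact abs_le.2 ⟨by change -lam ≤ clamp β lam x.2.1; linarith, this.2⟩

/-- Lipschitz dependence of integral curves of `field` on the initial value. -/
lemma exists_dist_le (hβ : 0 ≤ β) (hβl : β ≤ lam) (hW : 0 ≤ W)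
    (hg : LipschitzOnWith Kg g (Icc β lam)) (A T : ℝ) (hT : 0 ≤ T) :
    ∃ C : ℝ, 0 < C ∧ ∀ X Y, |(X 0).1| ≤ A → |(Y 0).1| ≤ A → IsCurve (field g β lam W) T X →
      IsCurve (field g β lam W) T Y → ∀ t ∈ Icc 0 T, dist (X t) (Y t) ≤ dist (X 0) (Y 0) * C := by
  by_cases hA : 0 ≤ A
  swap
  · exact ⟨1, one_pos, fun X Y h => absurd ((abs_nonneg _).trans h) hA⟩
  have hl : 0 ≤ lam := hβ.trans hβl
  obtain ⟨K, hK⟩ := lipschitzWith_truncField (M := A + lam * T) hβl hW (by positivity) hg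
  have key : ∀ X, |(X 0).1| ≤ A → IsCurve (field g β lam W) T X →
      IsCurve (truncField g β lam W (A + lam * T)) T X := by
    intro X h0 hX t ht
    rw [truncField_eq ((hX.abs_fst_le (abs_field_fst_le hβ hβl) t ht).trans (by linarith))]
    exact hX t ht
  refine ⟨Real.exp (K * T), Real.exp_pos _, fun X Y hX0 hY0 hX hY t ht => ?_⟩
  refine ((key X hX0 hX).dist_le hK (key Y hY0 hY) t ht).trans ?_
  gcongr
  exact ht.2

lemma IsCurve.eqOn (hβ : 0 ≤ β) (hβl : β ≤ lam) (hW : 0 ≤ W)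
    (hg : LipschitzOnWith Kg g (Icc β lam)) {T : ℝ} {X Y : ℝ → ℝ × ℝ × ℝ} (h0 : X 0 = Y 0)
    (hX : IsCurve (field g β lam W) T X) (hY : IsCurve (field g β lam W) T Y) :
    EqOn X Y (Icc 0 T) := by
  intro t ht
  obtain ⟨C, -, hC⟩ := exists_dist_le hβ hβl hW hg |(X 0).1| T (ht.1.trans ht.2)
  have := hC X Y le_rfl (by rw [h0]) hX hY t ht
  rw [h0, dist_self, zero_mul] at this
  exact dist_le_zero.1 this

lemma exists_global_field_curve (hβ : 0 ≤ β) (hβl : β ≤ lam) (hW : 0 ≤ W)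
    (hg : LipschitzOnWith Kg g (Icc β lam)) (x₀ : ℝ × ℝ × ℝ) :
    ∃ X : ℝ → ℝ × ℝ × ℝ, X 0 = x₀ ∧
      ∀ t ∈ Ici (0 : ℝ), HasDerivWithinAt X (field g β lam W (X t)) (Ici 0) t := by
  have hl : 0 ≤ lam := hβ.trans hβl
  refine exists_global_curve (fun n => ?_) fun T X Y hX0 hY0 hX hY =>
    hX.eqOn hβ hβl hW hg (hX0.trans hY0.symm) hY
  have hM : 0 ≤ |x₀.1| + lam * n := by positivity
  obtain ⟨K, hK⟩ := lipschitzWith_truncField hβl hW hM hg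
  obtain ⟨L, hL⟩ := norm_truncField_le hβ hβl hW hM hg
  obtain ⟨X, hX0, hX⟩ := exists_isCurve hK hL (Nat.cast_nonneg n) x₀
  refine ⟨X, hX0, fun t ht => ?_⟩
  rw [← truncField_eq (M := |x₀.1| + lam * n)]
  · exact hX t ht
  · rw [← hX0]
    exact hX.abs_fst_le (fun x => abs_field_fst_le hβ hβl _) t ht

end

lemma le_of_hasDerivWithinAt_nonneg {φ φ' : ℝ → ℝ} {a b : ℝ} (ha : 0 ≤ a) (hab : a ≤ b)
    (hφ : ∀ t ∈ Ici (0 : ℝ), HasDerivWithinAt φ (φ' t) (Ici 0) t)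
    (h : ∀ t ∈ Ioo a b, 0 ≤ φ' t) : φ a ≤ φ b := by
  have hsub : Icc a b ⊆ Ici 0 := fun t ht => ha.trans ht.1
  refine monotoneOn_of_hasDerivWithinAt_nonneg (f' := φ') (convex_Icc a b)
    (fun t ht => ((hφ t (hsub ht)).mono hsub).continuousWithinAt) ?_ ?_ ⟨le_rfl, hab⟩ ⟨hab, le_rfl⟩ hab
  · intro t ht
    rw [interior_Icc] at ht ⊢
    exact (hφ t (hsub (Ioo_subset_Icc_self ht))).mono (Ioo_subset_Icc_self.trans hsub)
  · intro t ht
    rw [interior_Icc] at ht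
    exact h t ht

lemma deriv_nonneg_of_right_min {φ : ℝ → ℝ} {d t : ℝ} (ht : 0 ≤ t)
    (hφ : HasDerivWithinAt φ d (Ici 0) t) (h : ∀ s, t ≤ s → φ t ≤ φ s) : 0 ≤ d := by
  have h1 : HasDerivWithinAt φ d (Ioi t) t := hφ.mono fun s hs => ht.trans (le_of_lt hs)
  rw [hasDerivWithinAt_iff_tendsto_slope' self_notMem_Ioi] at h1
  refine ge_of_tendsto h1 ?_
  filter_upwards [self_mem_nhdsWithin] with s hs
  rw [slope_def_field]
  exact div_nonneg (sub_nonneg.2 (h s (le_of_lt hs))) (sub_nonneg.2 (le_of_lt hs))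

/-- A trajectory of `field` in coordinates, starting at `(α, β, γ)`. -/
structure IsTrajectory (g : ℝ → ℝ) (β lam W α γ : ℝ) (f u w : ℝ → ℝ) : Prop where
  f_zero : f 0 = α
  u_zero : u 0 = β
  w_zero : w 0 = γ
  deriv_f : ∀ t ∈ Ici (0 : ℝ), HasDerivWithinAt f (clamp β lam (u t)) (Ici 0) t
  deriv_u : ∀ t ∈ Ici (0 : ℝ), HasDerivWithinAt u (clamp 0 W (w t)) (Ici 0) t
  deriv_w : ∀ t ∈ Ici (0 : ℝ), HasDerivWithinAt w
    (-(f t * clamp 0 W (w t)) - g (clamp β lam (u t))) (Ici 0) t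

/-- A solution of the equation `f''' + f f'' + g(f') = 0` with `f' = u` and `f'' = w`, such that
`u` is nondecreasing from `β` to `lam`. -/
structure IsProfile (g : ℝ → ℝ) (β lam α : ℝ) (f u w : ℝ → ℝ) : Prop where
  f_zero : f 0 = α
  u_zero : u 0 = β
  deriv_f : ∀ t ∈ Ici (0 : ℝ), HasDerivWithinAt f (u t) (Ici 0) t
  deriv_u : ∀ t ∈ Ici (0 : ℝ), HasDerivWithinAt u (w t) (Ici 0) t
  deriv_w : ∀ t ∈ Ici (0 : ℝ), HasDerivWithinAt w (-(f t * w t) - g (u t)) (Ici 0) t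
  w_nonneg : ∀ t ∈ Ici (0 : ℝ), 0 ≤ w t
  u_le : ∀ t ∈ Ici (0 : ℝ), u t ≤ lam
  tendsto : Tendsto u atTop (𝓝 lam)

lemma HasDerivWithinAt.continuousOn_Ici {φ φ' : ℝ → ℝ}
    (hφ : ∀ t ∈ Ici (0 : ℝ), HasDerivWithinAt φ (φ' t) (Ici 0) t) : ContinuousOn φ (Ici 0) :=
  fun t ht => (hφ t ht).continuousWithinAt

namespace IsTrajectory

variable {g : ℝ → ℝ} {β lam W α γ : ℝ} {f u w : ℝ → ℝ}

lemma u_mono (h : IsTrajectory g β lam W α γ f u w) (hW : 0 ≤ W) {a b : ℝ} (ha : 0 ≤ a)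
    (hab : a ≤ b) : u a ≤ u b :=
  le_of_hasDerivWithinAt_nonneg ha hab h.deriv_u fun _ _ => (clamp_mem hW _).1

lemma le_f (h : IsTrajectory g β lam W α γ f u w) (hβ : 0 ≤ β) (hβl : β ≤ lam) {t : ℝ}
    (ht : 0 ≤ t) : α ≤ f t := by
  rw [← h.f_zero]
  exact le_of_hasDerivWithinAt_nonneg le_rfl ht h.deriv_f fun _ _ => hβ.trans (clamp_mem hβl _).1

lemma f_le (h : IsTrajectory g β lam W α γ f u w) (hβl : β ≤ lam) {t : ℝ}
    (ht : 0 ≤ t) : f t ≤ α + lam * t := by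
  have := le_of_hasDerivWithinAt_nonneg (φ := fun t => lam * t - f t) le_rfl ht
    (fun s hs => (((hasDerivAt_id s).const_mul lam).hasDerivWithinAt).sub (h.deriv_f s hs))
    fun s _ => by linarith [(clamp_mem hβl (u s)).2]
  rw [h.f_zero] at this
  linarith

lemma w_le (h : IsTrajectory g β lam W α γ f u w) (hβ : 0 ≤ β) (hβl : β ≤ lam) (hW : 0 ≤ W)
    (hg : ∀ x ∈ Icc β lam, 0 ≤ g x) {t : ℝ} (ht : 0 ≤ t) : w t ≤ γ + |α| * (u t - β) := by
  have := le_of_hasDerivWithinAt_nonneg (φ := fun t => |α| * u t - w t) le_rfl ht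
    (fun s hs => ((h.deriv_u s hs).const_mul |α|).sub (h.deriv_w s hs))
    fun s hs => by
      have h1 := h.le_f hβ hβl hs.1.le
      have h2 := neg_abs_le α
      have h3 := mul_nonneg (show 0 ≤ |α| + f s by linarith) (clamp_mem hW (w s)).1
      linarith [hg _ (clamp_mem hβl (u s))]
  rw [h.u_zero, h.w_zero] at this
  linarith

/-- Once negative, `w` stays negative. -/
lemma w_neg_of_le (h : IsTrajectory g β lam W α γ f u w) (hβl : β ≤ lam) (hW : 0 ≤ W)
    (hg : ∀ x ∈ Icc β lam, 0 ≤ g x) {t₁ t : ℝ} (ht₁ : 0 ≤ t₁) (hw : w t₁ < 0) (ht : t₁ ≤ t) :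
    w t < 0 := by
  by_contra! hwt
  have hcont : ContinuousOn w (Icc t₁ t) :=
    (HasDerivWithinAt.continuousOn_Ici h.deriv_w).mono fun s hs => ht₁.trans hs.1
  have hS : IsCompact (Icc t₁ t ∩ w ⁻¹' Ici 0) :=
    isCompact_Icc.of_isClosed_subset (hcont.preimage_isClosed_of_isClosed isClosed_Icc isClosed_Ici)
      inter_subset_left
  obtain ⟨s, ⟨hs, hws⟩, hmin⟩ := hS.exists_isLeast ⟨t, ⟨ht, le_rfl⟩, hwt⟩
  have := le_of_hasDerivWithinAt_nonneg (φ := fun t => - w t) ht₁ hs.1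
    (fun s hs => (h.deriv_w s hs).neg) fun r hr => by
      have : w r < 0 := by
        by_contra! hc
        exact absurd (hmin ⟨⟨hr.1.le, hr.2.le.trans hs.2⟩, hc⟩) (not_le.2 hr.2)
      rw [clamp_of_le hW this.le]
      linarith [hg _ (clamp_mem hβl (u r))]
  simp only [mem_preimage, mem_Ici] at hws
  linarith

lemma u_le_of_w_neg (h : IsTrajectory g β lam W α γ f u w) (hβl : β ≤ lam) (hW : 0 ≤ W)
    (hγ : 0 ≤ γ) (hg : ∀ x ∈ Icc β lam, 0 ≤ g x) (hzero : g lam = 0) {t₁ : ℝ} (ht₁ : 0 ≤ t₁)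
    (hw : w t₁ < 0) : ∀ t, 0 ≤ t → u t ≤ lam := by
  have h1 : u t₁ ≤ lam := by
    by_contra! hlt
    have hcont : ContinuousOn w (Icc 0 t₁) :=
      (HasDerivWithinAt.continuousOn_Ici h.deriv_w).mono fun s hs => hs.1
    have hS : IsCompact (Icc 0 t₁ ∩ w ⁻¹' Ici 0) :=
      isCompact_Icc.of_isClosed_subset
        (hcont.preimage_isClosed_of_isClosed isClosed_Icc isClosed_Ici) inter_subset_left
    obtain ⟨s, ⟨hs, hws⟩, hmax⟩ := hS.exists_isGreatest
      ⟨0, ⟨le_rfl, ht₁⟩, by simpa [h.w_zero] using hγ⟩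
    have hneg : ∀ r ∈ Ioo s t₁, w r ≤ 0 := fun r hr => by
      by_contra! hc
      exact absurd (hmax ⟨⟨hs.1.trans hr.1.le, hr.2.le⟩, hc.le⟩) (not_le.2 hr.1)
    have hus : u t₁ ≤ u s := by
      have := le_of_hasDerivWithinAt_nonneg (φ := fun t => - u t) hs.1 hs.2
        (fun s hs => (h.deriv_u s hs).neg) fun r hr => by
          rw [clamp_of_le hW (hneg r hr), neg_zero]
      linarith
    have := le_of_hasDerivWithinAt_nonneg hs.1 hs.2 h.deriv_w fun r hr => by
      rw [clamp_of_le hW (hneg r hr), clamp_of_ge hβl, hzero]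
      · simp
      · linarith [h.u_mono hW hs.1 hr.1.le]
    simp only [mem_preimage, mem_Ici] at hws
    linarith
  intro t ht
  rcases le_total t t₁ with htt | htt
  · exact (h.u_mono hW ht htt).trans h1
  · have := le_of_hasDerivWithinAt_nonneg (φ := fun t => - u t) ht₁ htt
      (fun s hs => (h.deriv_u s hs).neg) fun r hr => by
        rw [clamp_of_le hW (h.w_neg_of_le hβl hW hg ht₁ hw hr.1.le).le, neg_zero]
    linarith

lemma exists_w_neg (h : IsTrajectory g β lam W α 0 f u w) (hβl : β ≤ lam) (hW : 0 ≤ W)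
    (hg : 0 < g β) : ∃ t, 0 ≤ t ∧ w t < 0 := by
  by_contra! hc
  have := deriv_nonneg_of_right_min le_rfl (h.deriv_w 0 self_mem_Ici) fun s hs => by
    rw [h.w_zero]; exact hc s hs
  rw [h.w_zero, h.u_zero, clamp_of_mem ⟨le_rfl, hW⟩, clamp_of_mem ⟨le_rfl, hβl⟩] at this
  linarith

/-- If the initial value of `w` is large, then `u` exceeds `lam`. -/
lemma exists_lt_u (h : IsTrajectory g β lam W α γ f u w) (hβ : 0 ≤ β) (hβl : β ≤ lam)
    (hW : lam - β + 1 ≤ W) {G : ℝ} (hG : ∀ x ∈ Icc β lam, g x ≤ G) (hG0 : 0 ≤ G)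
    (hγ : (|α| + lam) * (lam - β) + G + (lam - β) + 1 ≤ γ) : ∃ t, 0 ≤ t ∧ lam < u t := by
  by_contra! hc
  have hl : 0 ≤ lam := hβ.trans hβl
  have hW0 : 0 ≤ W := by linarith
  have hw : ∀ t ∈ Icc (0 : ℝ) 1, lam - β + 1 ≤ w t := by
    intro t ht
    have := le_of_hasDerivWithinAt_nonneg (φ := fun t => w t + (|α| + lam) * u t + G * t) le_rfl
      ht.1 (fun s hs => ((h.deriv_w s hs).add ((h.deriv_u s hs).const_mul (|α| + lam))).add
        (((hasDerivAt_id s).const_mul G).hasDerivWithinAt)) fun s hs => by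
          have h1 := h.f_le hβl hs.1.le
          have h2 : lam * s ≤ lam * 1 := by gcongr; exact hs.2.le.trans ht.2
          have h3 := le_abs_self α
          have h4 := mul_nonneg (show 0 ≤ |α| + lam - f s by linarith) (clamp_mem hW0 (w s)).1
          linarith [hG _ (clamp_mem hβl (u s))]
    rw [h.w_zero, h.u_zero] at this
    have h1 : (|α| + lam) * u t ≤ (|α| + lam) * lam := by gcongr; exact hc t ht.1
    have h2 : G * t ≤ G * 1 := by gcongr; exact ht.2
    linarith
  have := le_of_hasDerivWithinAt_nonneg (φ := fun t => u t - (lam - β + 1) * t) le_rfl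
    zero_le_one (fun s hs => (h.deriv_u s hs).sub
      (((hasDerivAt_id s).const_mul (lam - β + 1)).hasDerivWithinAt)) fun s hs => by
        have h1 := hw s (Ioo_subset_Icc_self hs)
        have : lam - β + 1 ≤ clamp 0 W (w s) := le_max_of_le_right (le_min hW h1)
        linarith
  rw [h.u_zero] at this
  linarith [hc 1 zero_le_one]

/-- A trajectory on which no truncation is active is a profile. -/
lemma isProfile (h : IsTrajectory g β lam W α γ f u w) (hβ : 0 ≤ β) (hβl : β < lam)
    (hγ : 0 ≤ γ) (hW : γ + |α| * (lam - β) ≤ W) (hgc : ContinuousOn g (Icc β lam))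
    (hpos : ∀ x ∈ Ico β lam, 0 < g x) (hzero : g lam = 0)
    (hw : ∀ t, 0 ≤ t → 0 ≤ w t) (hu : ∀ t, 0 ≤ t → u t ≤ lam) : IsProfile g β lam α f u w := by
  have hW0 : 0 ≤ W :=
    (add_nonneg hγ (mul_nonneg (abs_nonneg _) (sub_nonneg.2 hβl.le))).trans hW
  have hg : ∀ x ∈ Icc β lam, 0 ≤ g x := fun x hx => by
    rcases hx.2.lt_or_eq with hlt | rfl
    · exact (hpos x ⟨hx.1, hlt⟩).le
    · exact hzero.ge
  have hub : ∀ t, 0 ≤ t → u t ∈ Icc β lam := fun t ht =>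
    ⟨h.u_zero ▸ h.u_mono hW0 le_rfl ht, hu t ht⟩
  have hwb : ∀ t, 0 ≤ t → w t ∈ Icc 0 W := fun t ht => by
    refine ⟨hw t ht, (h.w_le hβ hβl.le hW0 hg ht).trans (le_trans ?_ hW)⟩
    gcongr
    exact hu t ht
  have hdf : ∀ t ∈ Ici (0 : ℝ), HasDerivWithinAt f (u t) (Ici 0) t := fun t ht => by
    have := h.deriv_f t ht
    rwa [clamp_of_mem (hub t ht)] at this
  have hdu : ∀ t ∈ Ici (0 : ℝ), HasDerivWithinAt u (w t) (Ici 0) t := fun t ht => by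
    have := h.deriv_u t ht
    rwa [clamp_of_mem (hwb t ht)] at this
  have hdw : ∀ t ∈ Ici (0 : ℝ), HasDerivWithinAt w (-(f t * w t) - g (u t)) (Ici 0) t :=
    fun t ht => by
      have := h.deriv_w t ht
      rwa [clamp_of_mem (hub t ht), clamp_of_mem (hwb t ht)] at this
  refine ⟨h.f_zero, h.u_zero, hdf, hdu, hdw, hw, hu, tendsto_order.2 ⟨fun l hl => ?_, fun l hl => ?_⟩⟩
  · suffices ∃ t, 0 ≤ t ∧ l < u t by
      obtain ⟨t, ht, hlt⟩ := this
      filter_upwards [eventually_ge_atTop t] with s hs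
      exact hlt.trans_le (h.u_mono hW0 ht hs)
    by_contra! hc
    have hβl' : β ≤ l := h.u_zero ▸ hc 0 le_rfl
    obtain ⟨x, hx, hmin⟩ := isCompact_Icc.exists_isMinOn (nonempty_Icc.2 hβl')
      (hgc.mono (Icc_subset_Icc_right hl.le))
    have hc0 : 0 < g x := hpos x ⟨hx.1, hx.2.trans_lt hl⟩
    have key : ∀ t, 0 ≤ t → g x * t ≤ |α| * (lam - β) + γ := by
      intro t ht
      have := le_of_hasDerivWithinAt_nonneg (φ := fun t => |α| * u t - w t - g x * t) le_rfl ht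
        (fun s hs => (((hdu s hs).const_mul |α|).sub (hdw s hs)).sub
          (((hasDerivAt_id s).const_mul (g x)).hasDerivWithinAt))
        fun s hs => by
          have h1 := h.le_f hβ hβl.le hs.1.le
          have h2 := neg_abs_le α
          have h3 := mul_nonneg (show 0 ≤ |α| + f s by linarith) (hw s hs.1.le)
          have h4 : g x ≤ g (u s) := hmin ⟨(hub s hs.1.le).1, hc s hs.1.le⟩
          linarith
      rw [h.u_zero, h.w_zero] at this
      have h5 : |α| * u t ≤ |α| * lam := by gcongr; exact hu t ht
      linarith [hw t ht]
    have h0 : 0 ≤ |α| * (lam - β) + γ :=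
      add_nonneg (mul_nonneg (abs_nonneg _) (sub_nonneg.2 hβl.le)) hγ
    have := key ((|α| * (lam - β) + γ + 1) / g x) (by positivity)
    rw [mul_div_cancel₀ _ hc0.ne'] at this
    linarith
  · filter_upwards [eventually_ge_atTop 0] with s hs
    exact (hu s hs).trans_lt hl

end IsTrajectory

lemma exists_isTrajectory {g : ℝ → ℝ} {β lam W : ℝ} {Kg : ℝ≥0} (hβ : 0 ≤ β) (hβl : β ≤ lam)
    (hW : 0 ≤ W) (hg : LipschitzOnWith Kg g (Icc β lam)) (α : ℝ) :
    ∃ f u w : ℝ → ℝ → ℝ, (∀ γ, IsTrajectory g β lam W α γ (f γ) (u γ) (w γ)) ∧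
      (∀ t, 0 ≤ t → Continuous fun γ => u γ t) ∧ ∀ t, 0 ≤ t → Continuous fun γ => w γ t := by
  choose X hX0 hX using fun γ : ℝ => exists_global_field_curve hβ hβl hW hg (α, β, γ)
  have hcont : ∀ t, 0 ≤ t → Continuous fun γ => X γ t := by
    intro t ht
    obtain ⟨C, hC0, hC⟩ := exists_dist_le hβ hβl hW hg |α| t ht
    have hcurve : ∀ γ, IsCurve (field g β lam W) t (X γ) := fun γ s hs =>
      (hX γ s hs.1).mono Icc_subset_Ici_self
    refine (LipschitzWith.of_dist_le_mul (K := C.toNNReal) fun γ γ' => ?_).continuous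
    have := hC (X γ) (X γ') (by rw [hX0]) (by rw [hX0]) (hcurve γ) (hcurve γ') t ⟨ht, le_rfl⟩
    rw [hX0, hX0] at this
    have h2 : dist ((α, β, γ) : ℝ × ℝ × ℝ) (α, β, γ') = dist γ γ' := by
      simp [Prod.dist_eq]
    rw [Real.coe_toNNReal _ hC0.le, mul_comm, ← h2]
    exact this
  refine ⟨fun γ t => (X γ t).1, fun γ t => (X γ t).2.1, fun γ t => (X γ t).2.2, fun γ => ?_,
    fun t ht => (hcont t ht).snd.fst, fun t ht => (hcont t ht).snd.snd⟩
  exact ⟨by simp [hX0], by simp [hX0], by simp [hX0], fun t ht => (hX γ t ht).fst,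
    fun t ht => (hX γ t ht).snd.fst, fun t ht => (hX γ t ht).snd.snd⟩

theorem exists_isProfile {g : ℝ → ℝ} {β lam : ℝ} {Kg : ℝ≥0} (hβ : 0 ≤ β) (hβl : β < lam)
    (hg : LipschitzOnWith Kg g (Icc β lam)) (hpos : ∀ x ∈ Ico β lam, 0 < g x)
    (hzero : g lam = 0) (α : ℝ) : ∃ f u w, IsProfile g β lam α f u w := by
  have hl : 0 < lam := hβ.trans_lt hβl
  have hd : 0 ≤ lam - β := sub_nonneg.2 hβl.le
  have hg0 : ∀ x ∈ Icc β lam, 0 ≤ g x := fun x hx => by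
    rcases hx.2.lt_or_eq with hlt | rfl
    · exact (hpos x ⟨hx.1, hlt⟩).le
    · exact hzero.ge
  obtain ⟨G, hG⟩ := isCompact_Icc.exists_bound_of_continuousOn hg.continuousOn
  have hG0 : 0 ≤ G := (norm_nonneg _).trans (hG β ⟨le_rfl, hβl.le⟩)
  set Γ := (|α| + lam) * (lam - β) + G + (lam - β) + 1 with hΓ
  have hΓ1 : lam - β + 1 ≤ Γ := by
    have : 0 ≤ (|α| + lam) * (lam - β) := by positivity
    linarith
  set W := Γ + |α| * (lam - β) with hWdef
  have hWΓ : Γ ≤ W := by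
    have : 0 ≤ |α| * (lam - β) := by positivity
    linarith
  have hW : 0 ≤ W := by linarith
  obtain ⟨f, u, w, htraj, hu, hw⟩ := exists_isTrajectory hβ hβl.le hW hg α
  have hA : IsOpen {γ | ∃ t, 0 ≤ t ∧ w γ t < 0} := by
    have : {γ | ∃ t, 0 ≤ t ∧ w γ t < 0} = ⋃ t ∈ Ici (0 : ℝ), {γ | w γ t < 0} := by
      ext; simp
    rw [this]
    exact isOpen_biUnion fun t ht => isOpen_lt (hw t ht) continuous_const
  have hB : IsOpen {γ | ∃ t, 0 ≤ t ∧ lam < u γ t} := by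
    have : {γ | ∃ t, 0 ≤ t ∧ lam < u γ t} = ⋃ t ∈ Ici (0 : ℝ), {γ | lam < u γ t} := by
      ext; simp
    rw [this]
    exact isOpen_biUnion fun t ht => isOpen_lt continuous_const (hu t ht)
  have hne : ∃ γ ∈ Icc 0 Γ, (∀ t, 0 ≤ t → 0 ≤ w γ t) ∧ ∀ t, 0 ≤ t → u γ t ≤ lam := by
    by_contra! hc
    obtain ⟨γ, hγ, ⟨t, ht, hwt⟩, ⟨s, hs, hus⟩⟩ := (isPreconnected_Icc (a := 0) (b := Γ)) _ _ hA hB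
      (fun γ hγ => by
        by_cases h : ∀ t, 0 ≤ t → 0 ≤ w γ t
        · exact Or.inr (hc γ hγ h)
        · push Not at h
          exact Or.inl h)
      ⟨0, ⟨le_rfl, by linarith⟩, (htraj 0).exists_w_neg hβl.le hW (hpos β ⟨le_rfl, hβl⟩)⟩
      ⟨Γ, ⟨by linarith, le_rfl⟩, (htraj Γ).exists_lt_u hβ hβl.le (hΓ1.trans hWΓ)
        (fun x hx => (le_abs_self _).trans (hG x hx)) hG0 le_rfl⟩
    exact absurd ((htraj γ).u_le_of_w_neg hβl.le hW hγ.1 hg0 hzero ht hwt s hs) (not_le.2 hus)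
  obtain ⟨γ, hγ, h1, h2⟩ := hne
  exact ⟨f γ, u γ, w γ, (htraj γ).isProfile hβ hβl hγ.1 (by linarith [hγ.2]) hg.continuousOn
    hpos hzero h1 h2⟩

lemma le_of_hasDerivAt_nonneg {φ φ' : ℝ → ℝ} {b : ℝ} (hb : 0 ≤ b) (hc : ContinuousOn φ (Ici 0))
    (hφ : ∀ t, 0 < t → HasDerivAt φ (φ' t) t) (h : ∀ t ∈ Ioo 0 b, 0 ≤ φ' t) : φ 0 ≤ φ b := by
  refine monotoneOn_of_hasDerivWithinAt_nonneg (f' := φ') (convex_Icc 0 b)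
    (hc.mono Icc_subset_Ici_self) ?_ ?_ ⟨le_rfl, hb⟩ ⟨hb, le_rfl⟩ hb
  · intro t ht
    rw [interior_Icc] at ht ⊢
    exact (hφ t ht.1).hasDerivWithinAt
  · intro t ht
    rw [interior_Icc] at ht
    exact h t ht

/-- A comparison principle for cooperative systems. -/
lemma le_of_cooperative {A E A' E' : ℝ → ℝ} (hAc : ContinuousOn A (Ici 0))
    (hEc : ContinuousOn E (Ici 0)) (hA : ∀ t, 0 < t → HasDerivAt A (A' t) t)
    (hE : ∀ t, 0 < t → HasDerivAt E (E' t) t) (hE' : ∀ t, 0 < t → 0 < A t → 0 ≤ E' t)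
    (hA' : ∀ t, 0 < t → 0 < A t → 0 ≤ E t → 0 ≤ A' t) (hA0 : 0 < A 0) (hE0 : 0 ≤ E 0) :
    ∀ t, 0 ≤ t → A 0 ≤ A t := by
  have step : ∀ t, 0 ≤ t → (∀ s ∈ Ico 0 t, 0 < A s) → A 0 ≤ A t := by
    intro t ht hs
    refine le_of_hasDerivAt_nonneg ht hAc hA fun r hr => hA' r hr.1 (hs r ⟨hr.1.le, hr.2⟩) ?_
    exact hE0.trans (le_of_hasDerivAt_nonneg hr.1.le hEc hE fun q hq =>
      hE' q hq.1 (hs q ⟨hq.1.le, hq.2.trans hr.2⟩))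
  have hpos : ∀ t, 0 ≤ t → 0 < A t := by
    intro t ht
    by_contra! hlt
    have hS : IsCompact (Icc 0 t ∩ A ⁻¹' Iic 0) :=
      isCompact_Icc.of_isClosed_subset ((hAc.mono Icc_subset_Ici_self).preimage_isClosed_of_isClosed
        isClosed_Icc isClosed_Iic) inter_subset_left
    obtain ⟨s, ⟨hs, hAs⟩, hmin⟩ := hS.exists_isLeast ⟨t, ⟨ht, le_rfl⟩, hlt⟩
    have := step s hs.1 fun r hr => by
      by_contra! hc
      exact absurd (hmin ⟨⟨hr.1, hr.2.le.trans hs.2⟩, hc⟩) (not_le.2 hr.2)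
    simp only [mem_preimage, mem_Iic] at hAs
    linarith
  exact fun t ht => step t ht fun s hs => hpos s hs.1

namespace IsProfile

variable {g : ℝ → ℝ} {β lam α : ℝ} {Kg : ℝ≥0} {f u w : ℝ → ℝ}

lemma u_mem (h : IsProfile g β lam α f u w) {t : ℝ} (ht : 0 ≤ t) : u t ∈ Icc β lam :=
  ⟨h.u_zero ▸ le_of_hasDerivWithinAt_nonneg le_rfl ht h.deriv_u fun s hs => h.w_nonneg s hs.1.le,
    h.u_le t ht⟩

lemma u_lt (h : IsProfile g β lam α f u w) (hβ : 0 ≤ β) (hβl : β < lam)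
    (hg : LipschitzOnWith Kg g (Icc β lam)) (hzero : g lam = 0) {t : ℝ} (ht : 0 ≤ t) :
    u t < lam := by
  refine (h.u_le t ht).lt_of_ne fun hut => ?_
  have hl : 0 ≤ lam := hβ.trans hβl.le
  have hwt : w t = 0 := by
    refine le_antisymm ?_ (h.w_nonneg t ht)
    have := deriv_nonneg_of_right_min ht (h.deriv_u t ht).neg fun s hs => by
      simpa [hut] using h.u_le s (ht.trans hs)
    linarith
  obtain ⟨W, hWb⟩ := isCompact_Icc.exists_bound_of_continuousOn
    ((HasDerivWithinAt.continuousOn_Ici h.deriv_w).mono (Icc_subset_Ici_self : Icc 0 t ⊆ Ici 0))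
  obtain ⟨M, hM⟩ := isCompact_Icc.exists_bound_of_continuousOn
    ((HasDerivWithinAt.continuousOn_Ici h.deriv_f).mono (Icc_subset_Ici_self : Icc 0 t ⊆ Ici 0))
  simp only [Real.norm_eq_abs] at hWb hM
  have hW : 0 ≤ W := (abs_nonneg _).trans (hWb t ⟨ht, le_rfl⟩)
  have hM0 : 0 ≤ M := (abs_nonneg _).trans (hM t ⟨ht, le_rfl⟩)
  have hlt : 0 ≤ lam * t := by positivity
  obtain ⟨K, hK⟩ := lipschitzWith_truncField (M := M + lam * t) hβl.le hW (by positivity) hg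
  have hX : ∀ s, 0 ≤ s → HasDerivWithinAt (fun s => (f s, u s, w s))
      (u s, w s, -(f s * w s) - g (u s)) (Ici 0) s := fun s hs =>
    (h.deriv_f s hs).prodMk ((h.deriv_u s hs).prodMk (h.deriv_w s hs))
  have hY : ∀ s, HasDerivAt (fun s => (f t + lam * (s - t), lam, (0 : ℝ))) (lam, 0, 0) s := by
    intro s
    have h1 : HasDerivAt (fun s => f t + lam * (s - t)) lam s := by
      simpa using (((hasDerivAt_id s).sub_const t).const_mul lam).const_add (f t)
    exact h1.prodMk ((hasDerivAt_const s lam).prodMk (hasDerivAt_const s 0))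
  have := ODE_solution_unique_of_mem_Icc_left (v := fun _ => truncField g β lam W (M + lam * t))
    (s := fun _ => univ) (a := 0) (b := t) (f := fun s => (f s, u s, w s))
    (g := fun s => (f t + lam * (s - t), lam, (0 : ℝ))) (K := K)
    (fun _ _ => hK.lipschitzOnWith)
    (fun s hs => ((hX s hs.1).mono Icc_subset_Ici_self).continuousWithinAt)
    (fun s hs => by
      rw [truncField_eq (by linarith [hM s (Ioc_subset_Icc_self hs)]), field,
        clamp_of_mem (h.u_mem hs.1.le),
        clamp_of_mem ⟨h.w_nonneg s hs.1.le, (le_abs_self _).trans (hWb s (Ioc_subset_Icc_self hs))⟩]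
      exact ((hX s hs.1.le).hasDerivAt (Ici_mem_nhds hs.1)).hasDerivWithinAt)
    (fun _ _ => mem_univ _)
    (fun s _ => (hY s).continuousAt.continuousWithinAt)
    (fun s hs => by
      have hb : |f t + lam * (s - t)| ≤ M + lam * t := by
        have h1 := abs_le.1 (hM t ⟨ht, le_rfl⟩)
        have h2 : 0 ≤ lam * s := mul_nonneg hl hs.1.le
        have h3 : lam * s ≤ lam * t := by gcongr; exact hs.2
        exact abs_le.2 ⟨by linarith [h1.1], by linarith [h1.2]⟩
      rw [truncField_eq hb, field, clamp_of_mem ⟨hβl.le, le_rfl⟩, clamp_of_mem ⟨le_rfl, hW⟩]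
      simpa [hzero] using (hY s).hasDerivWithinAt)
    (fun _ _ => mem_univ _) (by simp [hut, hwt]) ⟨le_rfl, ht⟩
  have h0 : u 0 = lam := congrArg (fun x : ℝ × ℝ × ℝ => x.2.1) this
  rw [h.u_zero] at h0
  exact hβl.ne h0

lemma w_pos (h : IsProfile g β lam α f u w) (hβ : 0 ≤ β) (hβl : β < lam)
    (hg : LipschitzOnWith Kg g (Icc β lam)) (hpos : ∀ x ∈ Ico β lam, 0 < g x)
    (hzero : g lam = 0) {t : ℝ} (ht : 0 ≤ t) : 0 < w t := by
  refine (h.w_nonneg t ht).lt_of_ne' fun hwt => ?_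
  have := deriv_nonneg_of_right_min ht (h.deriv_w t ht) fun s hs => by
    rw [hwt]; exact h.w_nonneg s (ht.trans hs)
  have := hpos _ ⟨(h.u_mem ht).1, h.u_lt hβ hβl hg hzero ht⟩
  rw [hwt] at *
  linarith

lemma isCurve (h : IsProfile g β lam α f u w) {W T : ℝ} (hW : ∀ t ∈ Icc 0 T, w t ≤ W) :
    IsCurve (field g β lam W) T fun t => (f t, u t, w t) := by
  intro t ht
  rw [field, clamp_of_mem (h.u_mem ht.1), clamp_of_mem ⟨h.w_nonneg t ht.1, hW t ht⟩]
  exact ((h.deriv_f t ht.1).prodMk ((h.deriv_u t ht.1).prodMk (h.deriv_w t ht.1))).mono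
    Icc_subset_Ici_self

lemma eqOn_of_eq {f₁ u₁ w₁ f₂ u₂ w₂ : ℝ → ℝ} (h₁ : IsProfile g β lam α f₁ u₁ w₁)
    (h₂ : IsProfile g β lam α f₂ u₂ w₂) (hβ : 0 ≤ β) (hβl : β ≤ lam)
    (hg : LipschitzOnWith Kg g (Icc β lam)) (hw : w₁ 0 = w₂ 0) : EqOn f₁ f₂ (Ici 0) := by
  intro t ht
  obtain ⟨W₁, hW₁⟩ := isCompact_Icc.exists_bound_of_continuousOn
    ((HasDerivWithinAt.continuousOn_Ici h₁.deriv_w).mono (Icc_subset_Ici_self : Icc 0 t ⊆ Ici 0))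
  obtain ⟨W₂, hW₂⟩ := isCompact_Icc.exists_bound_of_continuousOn
    ((HasDerivWithinAt.continuousOn_Ici h₂.deriv_w).mono (Icc_subset_Ici_self : Icc 0 t ⊆ Ici 0))
  have hW : 0 ≤ max W₁ W₂ :=
    ((norm_nonneg _).trans (hW₁ t ⟨ht, le_rfl⟩)).trans (le_max_left _ _)
  have := (h₁.isCurve fun s hs => (le_abs_self _).trans ((hW₁ s hs).trans (le_max_left W₁ W₂))).eqOn
    hβ hβl hW hg (by simp [h₁.f_zero, h₂.f_zero, h₁.u_zero, h₂.u_zero, hw])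
    (h₂.isCurve fun s hs => (le_abs_self _).trans ((hW₂ s hs).trans (le_max_right W₁ W₂)))
    ⟨ht, le_rfl⟩
  exact congrArg Prod.fst this

/-- The inverse function of `u`. -/
lemma exists_inverse (h : IsProfile g β lam α f u w) (hw : ∀ t, 0 ≤ t → 0 < w t)
    (hu : ∀ t, 0 ≤ t → u t < lam) : ∃ σ : ℝ → ℝ, ContinuousOn σ (Ico β lam) ∧ σ β = 0 ∧
      (∀ y ∈ Ico β lam, 0 ≤ σ y ∧ u (σ y) = y) ∧
      ∀ y ∈ Ioo β lam, HasDerivAt σ (w (σ y))⁻¹ y := by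
  have hcont := HasDerivWithinAt.continuousOn_Ici h.deriv_u
  have hmono : StrictMonoOn u (Ici 0) := by
    refine strictMonoOn_of_hasDerivWithinAt_pos (f' := w) (convex_Ici 0) hcont ?_ ?_
    · intro t ht
      exact (h.deriv_u t (interior_subset ht)).mono interior_subset
    · exact fun t ht => hw t (interior_subset ht)
  let e : Ici (0 : ℝ) → Ico β lam := fun t => ⟨u t, (h.u_mem t.2).1, hu t t.2⟩
  have he : StrictMono e := fun a b hab => hmono a.2 b.2 hab
  have hs : Function.Surjective e := by
    rintro ⟨y, hy⟩
    obtain ⟨T, hT, hT0⟩ := (((tendsto_order.1 h.tendsto).1 y hy.2).and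
      (eventually_ge_atTop (0 : ℝ))).exists
    obtain ⟨s, hs, hsy⟩ := intermediate_value_Icc hT0 (hcont.mono Icc_subset_Ici_self)
      ⟨h.u_zero.le.trans hy.1, hT.le⟩
    exact ⟨⟨s, hs.1⟩, Subtype.ext hsy⟩
  let o := he.orderIsoOfSurjective e hs
  have ho : ∀ y : Ico β lam, u (o.symm y) = y := fun y =>
    congrArg Subtype.val (o.apply_symm_apply y)
  classical
  let σ : ℝ → ℝ := fun y => if hy : y ∈ Ico β lam then (o.symm ⟨y, hy⟩ : ℝ) else 0
  have hσ : ∀ y (hy : y ∈ Ico β lam), σ y = o.symm ⟨y, hy⟩ := fun y hy => dif_pos hy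
  have hinv : ∀ y ∈ Ico β lam, 0 ≤ σ y ∧ u (σ y) = y := fun y hy => by
    rw [hσ y hy]
    exact ⟨(o.symm ⟨y, hy⟩).2, ho ⟨y, hy⟩⟩
  have hσc : ContinuousOn σ (Ico β lam) := by
    rw [continuousOn_iff_continuous_domRestrict]
    have : (Ico β lam).domRestrict σ = fun y => (o.symm y : ℝ) := by
      ext y
      exact hσ y y.2
    rw [this]
    exact continuous_subtype_val.comp o.symm.continuous
  refine ⟨σ, hσc, ?_, hinv, fun y hy => ?_⟩
  · have hβ : β ∈ Ico β lam := ⟨le_rfl, h.u_zero ▸ hu 0 le_rfl⟩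
    exact hmono.injOn (hinv β hβ).1 self_mem_Ici ((hinv β hβ).2.trans h.u_zero.symm)
  · have hy' := Ioo_subset_Ico_self hy
    have hpos : 0 < σ y := (hinv y hy').1.lt_of_ne fun h0 => by
      have := (hinv y hy').2
      rw [← h0, h.u_zero] at this
      exact hy.1.ne this
    refine HasDerivAt.of_local_left_inverse (hσc.continuousAt (Ico_mem_nhds hy.1 hy.2))
      ((h.deriv_u _ hpos.le).hasDerivAt (Ici_mem_nhds hpos)) (hw _ hpos.le).ne' ?_
    filter_upwards [Ico_mem_nhds hy.1 hy.2] with z hz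
    exact (hinv z hz).2

/-- The value `f''(0)` is the same for all profiles. -/
lemma w_zero_le {f₁ u₁ w₁ f₂ u₂ w₂ : ℝ → ℝ} (h₁ : IsProfile g β lam α f₁ u₁ w₁)
    (h₂ : IsProfile g β lam α f₂ u₂ w₂) (hβ : 0 ≤ β) (hβl : β < lam)
    (hg : LipschitzOnWith Kg g (Icc β lam)) (hpos : ∀ x ∈ Ico β lam, 0 < g x)
    (hzero : g lam = 0) : w₁ 0 ≤ w₂ 0 := by
  by_contra! hlt
  have hu₁ : ∀ t, 0 ≤ t → u₁ t < lam := fun t ht => h₁.u_lt hβ hβl hg hzero ht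
  have hu₂ : ∀ t, 0 ≤ t → u₂ t < lam := fun t ht => h₂.u_lt hβ hβl hg hzero ht
  have hw₁ : ∀ t, 0 ≤ t → 0 < w₁ t := fun t ht => h₁.w_pos hβ hβl hg hpos hzero ht
  have hw₂ : ∀ t, 0 ≤ t → 0 < w₂ t := fun t ht => h₂.w_pos hβ hβl hg hpos hzero ht
  obtain ⟨σ, hσc, hσβ, hσ, hσd⟩ := h₂.exists_inverse hw₂ hu₂
  have hIco : ∀ t, 0 ≤ t → u₁ t ∈ Ico β lam := fun t ht => ⟨(h₁.u_mem ht).1, hu₁ t ht⟩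
  have hIoo : ∀ t, 0 < t → u₁ t ∈ Ioo β lam := fun t ht => by
    refine ⟨?_, hu₁ t ht.le⟩
    rw [← h₁.u_zero]
    refine strictMonoOn_of_hasDerivWithinAt_pos (f' := w₁) (convex_Ici 0)
      (HasDerivWithinAt.continuousOn_Ici h₁.deriv_u) ?_ ?_ self_mem_Ici ht.le ht
    · exact fun t ht => (h₁.deriv_u t (interior_subset ht)).mono interior_subset
    · exact fun t ht => hw₁ t (interior_subset ht)
  let τ : ℝ → ℝ := fun t => σ (u₁ t)
  have hτ0 : τ 0 = 0 := by simp only [τ, h₁.u_zero, hσβ]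
  have hτn : ∀ t, 0 ≤ t → 0 ≤ τ t := fun t ht => (hσ _ (hIco t ht)).1
  have hτu : ∀ t, 0 ≤ t → u₂ (τ t) = u₁ t := fun t ht => (hσ _ (hIco t ht)).2
  have hτp : ∀ t, 0 < t → 0 < τ t := fun t ht => (hτn t ht.le).lt_of_ne fun h0 => by
    have := hτu t ht.le
    rw [← h0, h₂.u_zero] at this
    exact (hIoo t ht).1.ne this
  have hτc : ContinuousOn τ (Ici 0) :=
    hσc.comp (HasDerivWithinAt.continuousOn_Ici h₁.deriv_u) fun t ht => hIco t ht
  have hτd : ∀ t, 0 < t → HasDerivAt τ ((w₂ (τ t))⁻¹ * w₁ t) t := fun t ht =>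
    (hσd _ (hIoo t ht)).comp t ((h₁.deriv_u t ht.le).hasDerivAt (Ici_mem_nhds ht))
  have hfd : ∀ t, 0 < t → HasDerivAt (fun t => f₂ (τ t) - f₁ t)
      (u₂ (τ t) * ((w₂ (τ t))⁻¹ * w₁ t) - u₁ t) t := fun t ht =>
    (((h₂.deriv_f _ (hτn t ht.le)).hasDerivAt (Ici_mem_nhds (hτp t ht))).comp t (hτd t ht)).sub
      ((h₁.deriv_f t ht.le).hasDerivAt (Ici_mem_nhds ht))
  have hwd : ∀ t, 0 < t → HasDerivAt (fun t => w₁ t - w₂ (τ t))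
      (-(f₁ t * w₁ t) - g (u₁ t) -
        (-(f₂ (τ t) * w₂ (τ t)) - g (u₂ (τ t))) * ((w₂ (τ t))⁻¹ * w₁ t)) t := fun t ht =>
    ((h₁.deriv_w t ht.le).hasDerivAt (Ici_mem_nhds ht)).sub
      (((h₂.deriv_w _ (hτn t ht.le)).hasDerivAt (Ici_mem_nhds (hτp t ht))).comp t (hτd t ht))
  have key := le_of_cooperative (A := fun t => w₁ t - w₂ (τ t)) (E := fun t => f₂ (τ t) - f₁ t)
    ((HasDerivWithinAt.continuousOn_Ici h₁.deriv_w).sub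
      ((HasDerivWithinAt.continuousOn_Ici h₂.deriv_w).comp hτc hτn))
    (((HasDerivWithinAt.continuousOn_Ici h₂.deriv_f).comp hτc hτn).sub
      (HasDerivWithinAt.continuousOn_Ici h₁.deriv_f)) hwd hfd
    (fun t ht hA => by
      have hp := hw₂ _ (hτn t ht.le)
      have h1 : 1 ≤ (w₂ (τ t))⁻¹ * w₁ t := by
        rw [inv_mul_eq_div, one_le_div hp]
        linarith
      have h2 : 0 ≤ u₁ t := hβ.trans (h₁.u_mem ht.le).1
      rw [hτu t ht.le]
      nlinarith)
    (fun t ht hA hE => by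
      have hp := hw₂ _ (hτn t ht.le)
      have h1 : -(f₁ t * w₁ t) - g (u₁ t) -
          (-(f₂ (τ t) * w₂ (τ t)) - g (u₂ (τ t))) * ((w₂ (τ t))⁻¹ * w₁ t) =
          (f₂ (τ t) - f₁ t) * w₁ t + g (u₁ t) * (w₁ t - w₂ (τ t)) / w₂ (τ t) := by
        rw [hτu t ht.le]
        field_simp
        ring
      rw [h1]
      have h2 := hpos _ (hIco t ht.le)
      have h3 := hw₁ t ht.le
      exact add_nonneg (mul_nonneg hE h3.le) (div_nonneg (mul_nonneg h2.le hA.le) hp.le))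
    (by simpa [hτ0] using hlt) (by simp [hτ0, h₁.f_zero, h₂.f_zero])
  simp only [hτ0] at key
  set c := w₁ 0 - w₂ 0 with hc
  have hc0 : 0 < c := sub_pos.2 hlt
  have hgrow : ∀ t, 0 ≤ t → β + c * t ≤ u₁ t := by
    intro t ht
    have := le_of_hasDerivWithinAt_nonneg (φ := fun t => u₁ t - c * t) le_rfl ht
      (fun s hs => (h₁.deriv_u s hs).sub (((hasDerivAt_id s).const_mul c).hasDerivWithinAt))
      fun s hs => by
        have h1 : c ≤ w₁ s - w₂ (τ s) := key s hs.1.le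
        linarith [hw₂ _ (hτn s hs.1.le)]
    rw [h₁.u_zero] at this
    linarith
  have := hgrow ((lam - β) / c) (div_nonneg (by linarith) hc0.le)
  rw [mul_div_cancel₀ _ hc0.ne'] at this
  linarith [hu₁ ((lam - β) / c) (div_nonneg (by linarith) hc0.le)]

lemma eqOn {f₁ u₁ w₁ f₂ u₂ w₂ : ℝ → ℝ} (h₁ : IsProfile g β lam α f₁ u₁ w₁)
    (h₂ : IsProfile g β lam α f₂ u₂ w₂) (hβ : 0 ≤ β) (hβl : β < lam)
    (hg : LipschitzOnWith Kg g (Icc β lam)) (hpos : ∀ x ∈ Ico β lam, 0 < g x)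
    (hzero : g lam = 0) : EqOn f₁ f₂ (Ici 0) :=
  h₁.eqOn_of_eq h₂ hβ hβl.le hg (le_antisymm (h₁.w_zero_le h₂ hβ hβl hg hpos hzero)
    (h₂.w_zero_le h₁ hβ hβl hg hpos hzero))

lemma isConvexSolution (h : IsProfile g β lam α f u w) {J : Set ℝ} (hJ : Icc β lam ⊆ J) :
    IsConvexSolution g J α β lam f := by
  have huniq : UniqueDiffOn ℝ (Ici (0 : ℝ)) := uniqueDiffOn_Ici 0
  have h1 : EqOn (D f) u (Ici 0) := fun t ht => (h.deriv_f t ht).derivWithin (huniq t ht)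
  have hd1 : ∀ t ∈ Ici (0 : ℝ), HasDerivWithinAt (D f) (w t) (Ici 0) t := fun t ht =>
    (h.deriv_u t ht).congr h1 (h1 ht)
  have h2 : EqOn (D (D f)) w (Ici 0) := fun t ht => (hd1 t ht).derivWithin (huniq t ht)
  have hd2 : ∀ t ∈ Ici (0 : ℝ), HasDerivWithinAt (D (D f)) (-(f t * w t) - g (u t)) (Ici 0) t :=
    fun t ht => (h.deriv_w t ht).congr h2 (h2 ht)
  refine ⟨⟨fun t ht => (h.deriv_f t ht).differentiableWithinAt,
    fun t ht => (hd1 t ht).differentiableWithinAt, fun t ht => (hd2 t ht).differentiableWithinAt,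
    fun t ht => hJ (h1 ht ▸ h.u_mem ht), fun t ht => ?_, h.f_zero,
    (h1 self_mem_Ici).trans h.u_zero, ?_⟩, ?_⟩
  · have h3 : D (D (D f)) t = -(f t * w t) - g (u t) := (hd2 t ht).derivWithin (huniq t ht)
    rw [h3, h2 ht, h1 ht]
    ring
  · refine h.tendsto.congr' ?_
    filter_upwards [eventually_ge_atTop 0] with t ht
    exact (h1 ht).symm
  · refine MonotoneOn.convexOn_of_deriv (convex_Ici 0)
      (HasDerivWithinAt.continuousOn_Ici h.deriv_f) ?_ ?_
    · intro t ht
      exact ((h.deriv_f t (interior_subset ht)).mono interior_subset).differentiableWithinAt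
    · rw [interior_Ici]
      intro a ha b hb hab
      have ha0 : 0 ≤ a := le_of_lt ha
      have hb0 : 0 ≤ b := le_of_lt hb
      rw [((h.deriv_f a ha0).hasDerivAt (Ici_mem_nhds ha)).deriv,
        ((h.deriv_f b hb0).hasDerivAt (Ici_mem_nhds hb)).deriv]
      exact le_of_hasDerivWithinAt_nonneg ha0 hab h.deriv_u fun s hs =>
        h.w_nonneg s (ha0.trans hs.1.le)

end IsProfile

lemma IsConvexSolution.isProfile {g : ℝ → ℝ} {J : Set ℝ} {α β lam : ℝ} {f : ℝ → ℝ}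
    (h : IsConvexSolution g J α β lam f) : IsProfile g β lam α f (D f) (D (D f)) := by
  obtain ⟨h, hconv⟩ := h
  have hmono : MonotoneOn (D f) (Ici 0) := hconv.monotoneOn_derivWithin h.diff_zero
  refine ⟨h.value_zero, h.deriv_zero, fun t ht => (h.diff_zero t ht).hasDerivWithinAt,
    fun t ht => (h.diff_one t ht).hasDerivWithinAt, fun t ht => ?_,
    fun t _ => hmono.derivWithin_nonneg, fun t ht => ?_, h.deriv_infty⟩
  · have h1 : -(f t * D (D f) t) - g (D f t) = D (D (D f)) t := by linarith [h.ode t ht]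
    rw [h1]
    exact (h.diff_two t ht).hasDerivWithinAt
  · refine ge_of_tendsto h.deriv_infty ?_
    filter_upwards [eventually_ge_atTop t] with s hs
    exact hmono ht (le_trans (mem_Ici.1 ht) hs) hs

end SimilarityBL

theorem mainTheorem2 (g : ℝ → ℝ) (J : Set ℝ) (hJ : J.OrdConnected) (hg : LocallyLipschitzOn J g)
    (α β lam : ℝ) (hβJ : β ∈ J) (hlamJ : lam ∈ J) (hβ : 0 ≤ β) (hβlam : β < lam)
    (hpos : ∀ x ∈ Set.Ico β lam, 0 < g x) (hzero : g lam = 0) :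
    ∃ f : ℝ → ℝ, SimilarityBL.IsConvexSolution g J α β lam f ∧
      ∀ h : ℝ → ℝ, SimilarityBL.IsConvexSolution g J α β lam h → Set.EqOn h f (Set.Ici 0) := by
  have hsub : Set.Icc β lam ⊆ J := hJ.out hβJ hlamJ
  obtain ⟨K, hK⟩ := (hg.mono hsub).exists_lipschitzOnWith_of_compact isCompact_Icc
  obtain ⟨f, u, w, hf⟩ := SimilarityBL.exists_isProfile hβ hβlam hK hpos hzero α
  exact ⟨f, hf.isConvexSolution hsub, fun h hh =>
    hh.isProfile.eqOn hf hβ hβlam hK hpos hzero⟩
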